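/- **Theorem 9.2.** Let $\mathfrak g=\mathfrak{sl}_2$ over $\mathbb C$ with Chevalley generators $e,f,h$, simple root $\alpha_1$, and invariant form normalized by $(\alpha_1,\alpha_1)=2$; let $\rho=\alpha_1/2$. Let $k\ge 0$ be an integer, let $V$ be the irreducible $\mathfrak g$-module of highest weight $\Lambda=k\alpha_1$ with highest weight vector $v_\Lambda$, and let $S$ be its Shapovalov form, i.e. the bilinear form induced from the Verma module with $S(v_\Lambda,v_\Lambda)=1$, $S(ex,y)=S(x,fy)$, $S(fx,y)=S(x,ey)$. Let $\xi\in\mathfrak h^*$ and $\xi_1=(\xi,\alpha_1)$. *Critical points.* A critical point of the master function $$\Phi_H(t)=\sum_{i<j}2\log(t_i-t_j)-\sum_{j=1}^k 2k\log(t_j-1)-\sum_{j=1}^k(\xi_1-1)\log t_j$$ is a point $t=(t_1,\dots,t_k)\in\mathbb C^k$ with distinct coordinates different from $0$ and $1$ such that $$\sum_{i\ne j}\frac{2}{t_j-t_i}-\frac{2k}{t_j-1}-\frac{\xi_1-1}{t_j}=0,\qquad j=1,\dots,k.$$ *Weight function.* $$u(t)=\sum_{\sigma\in S_k}\frac{1}{(t_{\sigma(1)}-t_{\sigma(2)})\cdots(t_{\sigma(k-1)}-t_{\sigma(k)})(t_{\sigma(k)}-1)}\,f^kv_\Lambda\in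 V[0].$$ *Eigenfunctions.* Put $\mu=\xi-\rho$. Let $\omega$ be the Chevalley involution of $U(\mathfrak g)$ ($\omega(e)=-f$, $\omega(f)=-e$, $\omega(h)=-h$), and let $S_\mu(g_1,g_2)$, for $g_1,g_2\in U(\mathfrak g)$, be the Shapovalov form of $g_1\mathbf 1_\mu$ and $g_2\mathbf 1_\mu$ in the Verma module $M_\mu$ with highest weight vector $\mathbf 1_\mu$. Let $V[0]_\mu$ be the set of vectors in $V[0]$ annihilated by all elements of $U(\mathfrak n_+)$ that annihilate the lowest weight vector $\mathbf 1_\mu^*$ of the restricted dual $M_\mu^*$. For $u\in V[0]_\mu$ put $u_j=S_\mu(f^j,f^j)^{-1}\omega(f^j)u$ (understood as $0$ if $S_\mu(f^j,f^j)=0$, in which case $\omega(f^j)u=0$) and, for $\lambda\in\mathfrak h$, $X=e^{-2\pi i\alpha_1(\lambda)}$, $$\psi_u^\xi(\lambda)=e^{2\pi i\xi(\lambda)}\sum_{j\ge0}\Big(\sum_{\sigma\in S_j}\prod_{l=1}^{j}\frac{X^{a_l^\sigma+1}}{1-X^l}\Big)f^ju_j,$$ where $a_l^\sigma$ is the number of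 $i\in\{l,\dots,j-1\}$ with $\sigma(i)>\sigma(i+1)$. *Scalar product.* With $\lambda_1=(\lambda,\alpha_1)$ and any $\delta>0$, $$\langle\psi_1,\psi_2\rangle=\int_{-i\delta}^{1-i\delta}S(\psi_1(\lambda),\psi_2(-\lambda))\,d\lambda_1 .$$ Let $t_{cr}$ be a critical point of $\Phi_H$. Then $\xi_1\notin\{1,\dots,k\}$, the vector $u(t_{cr})$ lies in $V[0]_{\xi-\rho}$ (so that $\psi^\xi_{u(t_{cr})}$ is defined), and for every $\delta>0$ $$\left\langle\psi^\xi_{u(t_{cr})},\psi^\xi_{u(t_{cr})}\right\rangle=\frac{[(\xi_1+1)(\xi_1+2)\cdots(\xi_1+k)]^3\,k!}{(\xi_1-1)(\xi_1-2)\cdots(\xi_1-k)\,(k+1)(k+2)\cdots(2k)}.$$ -/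

import Mathlib

open scoped BigOperators Nat

noncomputable section

namespace KZB

attribute [local instance 100] LieRing.ofAssociativeRing

/-! ## The Lie algebra and its universal enveloping algebra

The invariant form on `sl₂` is the one with `(α₁, α₁) = 2`. A weight `ν ∈ 𝔥*` is recorded by the
number `ν(h) = (ν, α₁)`, and a point `x ∈ 𝔥` by the number `(x, α₁)`; so `ρ` is recorded as `1`,
`k α₁` as `2 k`, `ξ` as `ξ₁`, and `ν(x) = ν₁ x₁ / 2`. -/

/-- The Lie algebra of traceless complex `2 × 2` matrices. -/
abbrev sl2 : Type := LieAlgebra.SpecialLinear.sl (Fin 2) ℂ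

theorem mem_sl2 (A : Matrix (Fin 2) (Fin 2) ℂ) (hA : A 0 0 + A 1 1 = 0) :
    A ∈ LieAlgebra.SpecialLinear.sl (Fin 2) ℂ := by
  change A ∈ LinearMap.ker (Matrix.traceLinearMap (Fin 2) ℂ ℂ)
  simpa [Matrix.trace, Fin.sum_univ_two] using hA

theorem sl2_trace (x : sl2) : x.1 0 0 + x.1 1 1 = 0 := by
  have h : x.1 ∈ LinearMap.ker (Matrix.traceLinearMap (Fin 2) ℂ ℂ) := x.2
  simpa [Matrix.trace, Fin.sum_univ_two] using h

/-! Chevalley generators. -/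

def e : sl2 := ⟨!![0, 1; 0, 0], mem_sl2 _ (by simp)⟩

def f : sl2 := ⟨!![0, 0; 1, 0], mem_sl2 _ (by simp)⟩

def h : sl2 := ⟨!![1, 0; 0, -1], mem_sl2 _ (by simp)⟩

/-- The universal enveloping algebra `U(sl₂)`. -/
abbrev U : Type := UniversalEnvelopingAlgebra ℂ sl2

/-- The inclusion `sl₂ → U(sl₂)`. -/
abbrev inc : sl2 →ₗ⁅ℂ⁆ U := UniversalEnvelopingAlgebra.ι ℂ

/-- The Chevalley involution of `sl₂`, `x ↦ -xᵀ`. -/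
def chevalleyLie : sl2 →ₗ⁅ℂ⁆ sl2 where
  toFun x := ⟨-x.1.transpose, mem_sl2 _ (by
    have := sl2_trace x
    simp only [Matrix.neg_apply, Matrix.transpose_apply]
    linear_combination -this)⟩
  map_add' x y := by
    apply Subtype.ext
    change -(x.1 + y.1).transpose = -x.1.transpose + -y.1.transpose
    rw [Matrix.transpose_add, neg_add]
  map_smul' c x := by
    apply Subtype.ext
    change -(c • x.1).transpose = c • -x.1.transpose
    rw [Matrix.transpose_smul, smul_neg]
  map_lie' {x y} := by
    apply Subtype.ext
    change -(x.1 * y.1 - y.1 * x.1).transpose =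
      -x.1.transpose * -y.1.transpose - -y.1.transpose * -x.1.transpose
    rw [Matrix.transpose_sub, Matrix.transpose_mul, Matrix.transpose_mul, neg_mul_neg, neg_mul_neg,
      neg_sub]

theorem chevalleyLie_e : chevalleyLie e = -f := by
  apply Subtype.ext
  ext i j
  fin_cases i <;> fin_cases j <;> simp [chevalleyLie, e, f]

theorem chevalleyLie_f : chevalleyLie f = -e := by
  apply Subtype.ext
  ext i j
  fin_cases i <;> fin_cases j <;> simp [chevalleyLie, e, f]

theorem chevalleyLie_h : chevalleyLie h = -h := by
  apply Subtype.ext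
  ext i j
  fin_cases i <;> fin_cases j <;> simp [chevalleyLie, h]

/-- The Chevalley involution `ω`, as an automorphism of `U(sl₂)`:
`ω(e) = -f`, `ω(f) = -e`, `ω(h) = -h`. -/
def chevalley : U →ₐ[ℂ] U := UniversalEnvelopingAlgebra.lift ℂ (inc.comp chevalleyLie)

/-- `x ↦ -x` as a Lie homomorphism from `sl₂` to the opposite algebra of `U(sl₂)`. -/
def negOp : sl2 →ₗ⁅ℂ⁆ Uᵐᵒᵖ where
  toFun x := MulOpposite.op (-inc x)
  map_add' x y := by
    rw [map_add, neg_add, MulOpposite.op_add]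
  map_smul' c x := by
    simp
  map_lie' {x y} := by
    rw [LieHom.map_lie, Ring.lie_def, Ring.lie_def, ← MulOpposite.op_mul, ← MulOpposite.op_mul,
      ← MulOpposite.op_sub]
    congr 1
    noncomm_ring

/-- The antipode `a`, the anti-automorphism of `U(sl₂)` with `a(x) = -x` for `x ∈ sl₂`. -/
def antipode (g : U) : U := (UniversalEnvelopingAlgebra.lift ℂ negOp g).unop

/-- The action of `U(sl₂)` on a representation of `sl₂`. -/
def act (V : Type*) [AddCommGroup V] [Module ℂ V] [LieRingModule sl2 V] [LieModule ℂ sl2 V] :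
    U →ₐ[ℂ] Module.End ℂ V :=
  UniversalEnvelopingAlgebra.lift ℂ (LieModule.toEnd ℂ sl2 V)

/-! ## Verma modules and the Shapovalov form -/

/-- The Verma module `M_μ` of highest weight `μ`. The `j`-th basis vector is `f ^ j • 1_μ`. -/
def Verma (_μ : ℂ) : Type := ℕ →₀ ℂ

instance (μ : ℂ) : AddCommGroup (Verma μ) := inferInstanceAs (AddCommGroup (ℕ →₀ ℂ))

instance (μ : ℂ) : Module ℂ (Verma μ) := inferInstanceAs (Module ℂ (ℕ →₀ ℂ))

/-- The basis `f ^ j • 1_μ` of `M_μ`. -/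
def Verma.basis (μ : ℂ) : Module.Basis ℕ ℂ (Verma μ) := Finsupp.basisSingleOne

/-- `e f ^ j 1_μ = j (μ - j + 1) f ^ (j - 1) 1_μ` -/
def Verma.opE (μ : ℂ) : Module.End ℂ (Verma μ) :=
  (Verma.basis μ).constr ℂ fun j => ((j : ℂ) * (μ - j + 1)) • Verma.basis μ (j - 1)

/-- `f f ^ j 1_μ = f ^ (j + 1) 1_μ` -/
def Verma.opF (μ : ℂ) : Module.End ℂ (Verma μ) :=
  (Verma.basis μ).constr ℂ fun j => Verma.basis μ (j + 1)

/-- `h f ^ j 1_μ = (μ - 2 j) f ^ j 1_μ` -/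
def Verma.opH (μ : ℂ) : Module.End ℂ (Verma μ) :=
  (Verma.basis μ).constr ℂ fun j => (μ - 2 * j) • Verma.basis μ j

theorem Verma.opE_basis (μ : ℂ) (j : ℕ) :
    Verma.opE μ (Verma.basis μ j) = ((j : ℂ) * (μ - j + 1)) • Verma.basis μ (j - 1) :=
  Module.Basis.constr_basis _ _ _ _

theorem Verma.opF_basis (μ : ℂ) (j : ℕ) :
    Verma.opF μ (Verma.basis μ j) = Verma.basis μ (j + 1) :=
  Module.Basis.constr_basis _ _ _ _

theorem Verma.opH_basis (μ : ℂ) (j : ℕ) :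
    Verma.opH μ (Verma.basis μ j) = (μ - 2 * j) • Verma.basis μ j :=
  Module.Basis.constr_basis _ _ _ _

theorem Verma.lie_EF (μ : ℂ) :
    Verma.opE μ * Verma.opF μ - Verma.opF μ * Verma.opE μ = Verma.opH μ := by
  refine (Verma.basis μ).ext fun j => ?_
  simp only [LinearMap.sub_apply, Module.End.mul_apply, Verma.opE_basis, Verma.opF_basis,
    Verma.opH_basis, map_smul]
  rcases j with _ | j
  · simp
  · simp only [Nat.add_sub_cancel, ← sub_smul]
    congr 1
    push_cast
    ring

theorem Verma.lie_HE (μ : ℂ) :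
    Verma.opH μ * Verma.opE μ - Verma.opE μ * Verma.opH μ = (2 : ℂ) • Verma.opE μ := by
  refine (Verma.basis μ).ext fun j => ?_
  simp only [LinearMap.sub_apply, LinearMap.smul_apply, Module.End.mul_apply, Verma.opE_basis,
    Verma.opH_basis, map_smul]
  rcases j with _ | j
  · simp
  · simp only [Nat.add_sub_cancel, ← sub_smul, smul_smul]
    congr 1
    push_cast
    ring

theorem Verma.lie_HF (μ : ℂ) :
    Verma.opH μ * Verma.opF μ - Verma.opF μ * Verma.opH μ = (-2 : ℂ) • Verma.opF μ := by
  refine (Verma.basis μ).ext fun j => ?_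
  simp only [LinearMap.sub_apply, LinearMap.smul_apply, Module.End.mul_apply, Verma.opF_basis,
    Verma.opH_basis, map_smul]
  simp only [← sub_smul]
  congr 1
  push_cast
  ring

/-- The action of `sl₂` on `M_μ`. -/
def Verma.rep (μ : ℂ) : sl2 →ₗ⁅ℂ⁆ Module.End ℂ (Verma μ) where
  toFun x := x.1 0 1 • Verma.opE μ + x.1 1 0 • Verma.opF μ + x.1 0 0 • Verma.opH μ
  map_add' x y := by
    change (x.1 0 1 + y.1 0 1) • _ + (x.1 1 0 + y.1 1 0) • _ + (x.1 0 0 + y.1 0 0) • _ = _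
    module
  map_smul' c x := by
    change (c * x.1 0 1) • _ + (c * x.1 1 0) • _ + (c * x.1 0 0) • _ = c • (_ + _ + _)
    module
  map_lie' {x y} := by
    have hx : x.1 1 1 = - x.1 0 0 := by linear_combination sl2_trace x
    have hy : y.1 1 1 = - y.1 0 0 := by linear_combination sl2_trace y
    have h1 := Verma.lie_EF μ
    have h2 := Verma.lie_HE μ
    have h3 := Verma.lie_HF μ
    rw [sub_eq_iff_eq_add] at h1 h2 h3
    change (x.1 * y.1 - y.1 * x.1) 0 1 • _ + (x.1 * y.1 - y.1 * x.1) 1 0 • _ +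
      (x.1 * y.1 - y.1 * x.1) 0 0 • _ = _
    simp only [Ring.lie_def, Matrix.sub_apply, Matrix.mul_apply,
      Fin.sum_univ_two, hx, hy, mul_add, add_mul, smul_mul_assoc, mul_smul_comm, h1, h2, h3]
    module

instance (μ : ℂ) : LieRingModule sl2 (Verma μ) where
  bracket x m := Verma.rep μ x m
  add_lie x y m := by simp
  lie_add x m n := by simp
  leibniz_lie x y m := by
    simp [LieHom.map_lie, Ring.lie_def]

instance (μ : ℂ) : LieModule ℂ sl2 (Verma μ) where
  smul_lie c x m := by
    change Verma.rep μ (c • x) m = c • Verma.rep μ x m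
    simp
  lie_smul c x m := by
    change Verma.rep μ x (c • m) = c • Verma.rep μ x m
    simp

theorem Verma.lie_def (μ : ℂ) (x : sl2) (m : Verma μ) : ⁅x, m⁆ =
    x.1 0 1 • Verma.opE μ m + x.1 1 0 • Verma.opF μ m + x.1 0 0 • Verma.opH μ m := rfl

theorem Verma.e_lie (μ : ℂ) (m : Verma μ) : ⁅e, m⁆ = Verma.opE μ m := by
  simp [Verma.lie_def, e]

theorem Verma.f_lie (μ : ℂ) (m : Verma μ) : ⁅f, m⁆ = Verma.opF μ m := by
  simp [Verma.lie_def, f]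

theorem Verma.h_lie (μ : ℂ) (m : Verma μ) : ⁅h, m⁆ = Verma.opH μ m := by
  simp [Verma.lie_def, h]

/-- The highest weight vector `1_μ`. -/
def Verma.one (μ : ℂ) : Verma μ := Verma.basis μ 0

/-- The linear functional `1_μ^*` on `M_μ`, equal to `1` on `1_μ` and to `0` on the other weight
subspaces. -/
def Verma.dualOne (μ : ℂ) : Verma μ →ₗ[ℂ] ℂ := (Verma.basis μ).coord 0

/-- The functional `g ↦ γ(g)(μ)` on `U(sl₂)`: the value at `μ` of the projection
`γ : U(sl₂) → U(𝔥)` along `𝔫₋ U(sl₂) + U(sl₂) 𝔫₊`. It is the coefficient of `1_μ` in `g 1_μ`; the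
lemmas `projAt_f_mul`, `projAt_mul_e` and `projAt_h_pow` below show that this is the same. -/
def projAt (μ : ℂ) : U →ₗ[ℂ] ℂ :=
  Verma.dualOne μ ∘ₗ LinearMap.applyₗ (Verma.one μ) ∘ₗ (act (Verma μ)).toLinearMap

/-- The Shapovalov form `S_μ(g₁, g₂) = γ(a ω(g₁) g₂)(μ)` on `U(sl₂)`. -/
def shapovalovU (μ : ℂ) (g₁ g₂ : U) : ℂ := projAt μ (antipode (chevalley g₁) * g₂)

/-- The Shapovalov form on `M_μ`: the bilinear form with
`S(f ^ i 1_μ, f ^ j 1_μ) = S_μ(f ^ i, f ^ j)`. -/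
def Verma.form (μ : ℂ) : LinearMap.BilinForm ℂ (Verma μ) :=
  (Verma.basis μ).constr ℂ fun i => (Verma.basis μ).constr ℂ fun j =>
    shapovalovU μ (inc f ^ i) (inc f ^ j)

theorem act_inc (V : Type*) [AddCommGroup V] [Module ℂ V] [LieRingModule sl2 V]
    [LieModule ℂ sl2 V] (x : sl2) (v : V) : act V (inc x) v = ⁅x, v⁆ := by
  simp [act, inc]

theorem act_f_pow (μ : ℂ) (j : ℕ) :
    act (Verma μ) (inc f ^ j) (Verma.one μ) = Verma.basis μ j := by
  induction j with
  | zero => simp [Verma.one]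
  | succ j ih =>
    rw [pow_succ', map_mul, Module.End.mul_apply, ih, act_inc, Verma.f_lie, Verma.opF_basis]

theorem projAt_apply (μ : ℂ) (g : U) :
    projAt μ g = Verma.dualOne μ (act (Verma μ) g (Verma.one μ)) := rfl

theorem dualOne_basis (μ : ℂ) (j : ℕ) :
    Verma.dualOne μ (Verma.basis μ j) = if j = 0 then 1 else 0 := by
  rw [Verma.dualOne, Module.Basis.coord_apply, Module.Basis.repr_self, Finsupp.single_apply]

theorem projAt_f_mul (μ : ℂ) (g : U) : projAt μ (inc f * g) = 0 := by
  rw [projAt_apply, map_mul, Module.End.mul_apply, act_inc, Verma.f_lie]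
  have : Verma.dualOne μ ∘ₗ Verma.opF μ = 0 := by
    refine (Verma.basis μ).ext fun j => ?_
    simp [Verma.opF_basis, dualOne_basis]
  exact LinearMap.congr_fun this _

theorem projAt_mul_e (μ : ℂ) (g : U) : projAt μ (g * inc e) = 0 := by
  rw [projAt_apply, map_mul, Module.End.mul_apply, act_inc, Verma.e_lie, Verma.one,
    Verma.opE_basis]
  simp

theorem projAt_h_pow (μ : ℂ) (n : ℕ) : projAt μ (inc h ^ n) = μ ^ n := by
  have : act (Verma μ) (inc h ^ n) (Verma.one μ) = μ ^ n • Verma.one μ := by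
    induction n with
    | zero => simp
    | succ n ih =>
      rw [pow_succ', map_mul, Module.End.mul_apply, ih, map_smul, act_inc, Verma.h_lie,
        Verma.one, Verma.opH_basis, smul_smul]
      congr 1
      push_cast
      ring
  rw [projAt_apply, this, map_smul, Verma.one, dualOne_basis]
  simp

theorem antipode_mul (a b : U) : antipode (a * b) = antipode b * antipode a := by
  simp [antipode]

theorem antipode_inc (x : sl2) : antipode (inc x) = -inc x := by
  simp [antipode, negOp, inc]

theorem antipode_neg (a : U) : antipode (-a) = -antipode a := by
  simp [antipode]

theorem antipode_chevalley_f_pow (i : ℕ) : antipode (chevalley (inc f ^ i)) = inc e ^ i := by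
  have h1 : antipode (chevalley (inc f)) = inc e := by
    have : chevalley (inc f) = -inc e := by
      simp [chevalley, inc, chevalleyLie_f]
    rw [this, antipode_neg, antipode_inc, neg_neg]
  induction i with
  | zero => simp [antipode]
  | succ i ih => rw [pow_succ, map_mul, antipode_mul, ih, h1, pow_succ']

theorem form_basis (μ : ℂ) (i j : ℕ) :
    Verma.form μ (Verma.basis μ i) (Verma.basis μ j) =
      Verma.dualOne μ ((Verma.opE μ ^ i) (Verma.basis μ j)) := by
  have h2 : act (Verma μ) (inc e) = Verma.opE μ := by
    ext m
    rw [act_inc, Verma.e_lie]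
  rw [Verma.form, Module.Basis.constr_basis, Module.Basis.constr_basis, shapovalovU,
    antipode_chevalley_f_pow, projAt_apply, map_mul, Module.End.mul_apply, act_f_pow, map_pow, h2]

theorem form_basis_succ_zero (μ : ℂ) (i : ℕ) :
    Verma.form μ (Verma.basis μ (i + 1)) (Verma.basis μ 0) = 0 := by
  rw [form_basis, pow_succ, Module.End.mul_apply, Verma.opE_basis]
  simp

theorem form_basis_zero_succ (μ : ℂ) (j : ℕ) :
    Verma.form μ (Verma.basis μ 0) (Verma.basis μ (j + 1)) = 0 := by
  rw [form_basis, pow_zero, Module.End.one_apply, dualOne_basis]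
  simp

theorem form_basis_succ_succ (μ : ℂ) (i j : ℕ) :
    Verma.form μ (Verma.basis μ (i + 1)) (Verma.basis μ (j + 1)) =
      ((j + 1 : ℕ) : ℂ) * (μ - (j + 1 : ℕ) + 1) *
        Verma.form μ (Verma.basis μ i) (Verma.basis μ j) := by
  rw [form_basis, form_basis, pow_succ, Module.End.mul_apply, Verma.opE_basis, map_smul, map_smul,
    smul_eq_mul, Nat.add_sub_cancel]

theorem form_basis_ne (μ : ℂ) (i j : ℕ) (hij : i ≠ j) :
    Verma.form μ (Verma.basis μ i) (Verma.basis μ j) = 0 := by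
  induction i generalizing j with
  | zero =>
    rcases j with _ | j
    · exact absurd rfl hij
    · exact form_basis_zero_succ μ j
  | succ i ih =>
    rcases j with _ | j
    · exact form_basis_succ_zero μ i
    · rw [form_basis_succ_succ, ih j (by omega), mul_zero]

theorem form_F (μ : ℂ) (x y : Verma μ) :
    Verma.form μ (Verma.opF μ x) y = Verma.form μ x (Verma.opE μ y) := by
  have : Verma.form μ ∘ₗ Verma.opF μ = (Verma.form μ).compl₂ (Verma.opE μ) := by
    refine (Verma.basis μ).ext fun i => (Verma.basis μ).ext fun j => ?_
    rw [LinearMap.comp_apply, LinearMap.compl₂_apply, Verma.opF_basis, form_basis,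
      pow_succ, Module.End.mul_apply, Verma.opE_basis, map_smul, map_smul, map_smul, form_basis]
  exact LinearMap.congr_fun (LinearMap.congr_fun this x) y

theorem form_E (μ : ℂ) (x y : Verma μ) :
    Verma.form μ (Verma.opE μ x) y = Verma.form μ x (Verma.opF μ y) := by
  have : Verma.form μ ∘ₗ Verma.opE μ = (Verma.form μ).compl₂ (Verma.opF μ) := by
    refine (Verma.basis μ).ext fun i => (Verma.basis μ).ext fun j => ?_
    rw [LinearMap.comp_apply, LinearMap.compl₂_apply, Verma.opF_basis, Verma.opE_basis, map_smul,
      LinearMap.smul_apply, smul_eq_mul]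
    rcases i with _ | i
    · rw [form_basis_zero_succ]
      simp
    · rw [form_basis_succ_succ, Nat.add_sub_cancel]
      by_cases hij : i = j
      · rw [hij]
      · rw [form_basis_ne μ i j hij]
        simp
  exact LinearMap.congr_fun (LinearMap.congr_fun this x) y

theorem form_H (μ : ℂ) (x y : Verma μ) :
    Verma.form μ (Verma.opH μ x) y = Verma.form μ x (Verma.opH μ y) := by
  rw [← Verma.lie_EF]
  simp only [LinearMap.sub_apply, Module.End.mul_apply, map_sub, form_E, form_F]

theorem form_symm (μ : ℂ) (x y : Verma μ) : Verma.form μ x y = Verma.form μ y x := by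
  have : Verma.form μ = (Verma.form μ).flip := by
    refine (Verma.basis μ).ext fun i => (Verma.basis μ).ext fun j => ?_
    change _ = Verma.form μ (Verma.basis μ j) (Verma.basis μ i)
    by_cases hij : i = j
    · rw [hij]
    · rw [form_basis_ne μ i j hij, form_basis_ne μ j i (Ne.symm hij)]
  exact LinearMap.congr_fun (LinearMap.congr_fun this x) y

/-- The kernel of the Shapovalov form, the maximal proper submodule of `M_μ`. -/
def Verma.formKer (μ : ℂ) : LieSubmodule ℂ sl2 (Verma μ) :=
  { LinearMap.ker (Verma.form μ) with
    lie_mem := by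
      intro x m hm
      have hm' : Verma.form μ m = 0 := hm
      change Verma.form μ ⁅x, m⁆ = 0
      ext y
      rw [Verma.lie_def]
      simp only [map_add, map_smul, LinearMap.add_apply, LinearMap.smul_apply, form_E, form_F,
        form_H, hm', LinearMap.zero_apply, smul_zero, add_zero] }

/-- The irreducible module `L_μ` of highest weight `μ`. -/
abbrev Irr (μ : ℂ) : Type := Verma μ ⧸ Verma.formKer μ

/-- The highest weight vector of `L_μ`, the image of `1_μ`. -/
def Irr.hwVector (μ : ℂ) : Irr μ := LieSubmodule.Quotient.mk (Verma.one μ)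

/-- The Shapovalov form on `L_μ`, induced by the one on `M_μ`. -/
def Irr.form (μ : ℂ) : LinearMap.BilinForm ℂ (Irr μ) :=
  (Verma.formKer μ).toSubmodule.liftQ
    (LinearMap.flip ((Verma.formKer μ).toSubmodule.liftQ (LinearMap.flip (Verma.form μ)) (by
      intro m hm
      have hm' : Verma.form μ m = 0 := hm
      rw [LinearMap.mem_ker]
      ext y
      change Verma.form μ y m = 0
      rw [form_symm, hm', LinearMap.zero_apply])))
    (by
      intro m hm
      have hm' : Verma.form μ m = 0 := hm
      rw [LinearMap.mem_ker]
      ext y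
      obtain ⟨y, rfl⟩ := Submodule.Quotient.mk_surjective _ y
      change Verma.form μ m y = 0
      rw [hm', LinearMap.zero_apply])

theorem Irr.form_mk (μ : ℂ) (x y : Verma μ) :
    Irr.form μ (LieSubmodule.Quotient.mk x) (LieSubmodule.Quotient.mk y) = Verma.form μ x y := rfl

/-! ## The Bethe eigenfunction -/

section Eigenfunctions

variable (V : Type*) [AddCommGroup V] [Module ℂ V] [LieRingModule sl2 V] [LieModule ℂ sl2 V]

/-- The zero weight subspace `V[0]`. -/
def zeroWeight : Submodule ℂ V := LinearMap.ker (LieModule.toEnd ℂ sl2 V h)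

/-- The ideal `I_μ` of those `E ∈ U(𝔫₊)` that annihilate `1_μ^*` in the restricted dual of `M_μ`,
where `g ∈ U(sl₂)` acts on `φ` by `(g φ)(m) = φ(a(g) m)`. -/
def annIdeal (μ : ℂ) : Set U :=
  {E | E ∈ Algebra.adjoin ℂ {inc e} ∧
    ∀ m : Verma μ, Verma.dualOne μ (act (Verma μ) (antipode E) m) = 0}

/-- The subspace `V[0]_μ` of vectors of `V[0]` annihilated by `I_μ`. -/
def zeroWeightAnn (μ : ℂ) : Submodule ℂ V where
  carrier := {u | u ∈ zeroWeight V ∧ ∀ E ∈ annIdeal μ, act V E u = 0}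
  add_mem' := by
    rintro a b ⟨ha, ha'⟩ ⟨hb, hb'⟩
    exact ⟨add_mem ha hb, fun E hE => by rw [map_add, ha' E hE, hb' E hE, add_zero]⟩
  zero_mem' := ⟨zero_mem _, fun E _ => map_zero _⟩
  smul_mem' := by
    rintro c a ⟨ha, ha'⟩
    exact ⟨Submodule.smul_mem _ c ha, fun E hE => by rw [map_smul, ha' E hE, smul_zero]⟩

variable {V}

/-- The components `u_j` of `Ξ(μ)(1 ⊗ u) = ∑_j f ^ j ⊗ u_j`, that is
`u_j = (S_μ⁻¹)_{jj} ω(f ^ j) u`. The basis `f ^ j` of `U(𝔫₋)` has one element in each weight, so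
`S_μ` is diagonal. For `u ∈ V[0]_μ` the vector `ω(f ^ j) u` is zero whenever `S_μ(f ^ j, f ^ j)`
is, and the regular value of the product is then `0`, in accordance with `0⁻¹ = 0`. -/
def xiComponent (μ : ℂ) (u : V) (j : ℕ) : V :=
  (shapovalovU μ (inc f ^ j) (inc f ^ j))⁻¹ • act V (chevalley (inc f ^ j)) u

/-- For `σ ∈ S_m`, the number `a_k^σ` of descents of `σ` at positions `j ≥ k`
(positions are counted from `0`). -/
def descentsFrom {m : ℕ} (σ : Equiv.Perm (Fin m)) (k : Fin m) : ℕ :=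
  (Finset.univ.filter fun j : Fin m => k ≤ j ∧ ∃ hj : j.1 + 1 < m, σ ⟨j.1 + 1, hj⟩ < σ j).card

/-- The scalar by which `A_X` multiplies `f ^ m`: the sum over `σ ∈ S_m` of
`∏_{k = 1}^m X ^ (a_k^σ + 1) / (1 - X ^ k)`. -/
def coeffA (m : ℕ) (X : ℂ) : ℂ :=
  ∑ σ : Equiv.Perm (Fin m), ∏ k : Fin m, X ^ (descentsFrom σ k + 1) / (1 - X ^ (k.1 + 1))

/-- The function
`ψ_u^ξ(x) = exp(2 π i ξ(x)) ∑_j A_X(f ^ j) u_j`, where `∑_j f ^ j ⊗ u_j = Ξ(ξ - ρ)(1 ⊗ u)` and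
`X = exp(-2 π i α₁(x))`, as a function of the coordinate `x₁ = (x, α₁)` of `x ∈ 𝔥`. The sum is
finite when `e` acts locally nilpotently on `V`. -/
def psi (ξ₁ : ℂ) (u : V) (x₁ : ℂ) : V :=
  Complex.exp (Real.pi * Complex.I * ξ₁ * x₁) •
    ∑ᶠ j : ℕ, coeffA j (Complex.exp (-2 * Real.pi * Complex.I * x₁)) •
      act V (inc f ^ j) (xiComponent (ξ₁ - 1) u j)

/-- The scalar product `∫_C S(ψ₁(x), ψ₂(-x)) dx₁` of `V`-valued functions, where `x₁` ranges along
the segment from `0 - i δ` to `1 - i δ`. -/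
def scalarProduct (S : LinearMap.BilinForm ℂ V) (δ : ℝ) (ψ₁ ψ₂ : ℂ → V) : ℂ :=
  ∫ s in (0 : ℝ)..1, S (ψ₁ (s - δ * Complex.I)) (ψ₂ (-(s - δ * Complex.I)))

end Eigenfunctions

/-- Critical points `t ∈ ℂ^k` of the master function
`Φ_H(t) = ∑_{i < j} 2 log(t_i - t_j) - ∑_j 2 k log(t_j - 1) - ∑_j (ξ₁ - 1) log(t_j)`,
a multivalued function on the set where the `t_j` are distinct and different from `0` and `1`. -/
structure IsCriticalPoint (k : ℕ) (ξ₁ : ℂ) (t : Fin k → ℂ) : Prop where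
  injective : Function.Injective t
  ne_zero : ∀ j, t j ≠ 0
  ne_one : ∀ j, t j ≠ 1
  eqn : ∀ j, (∑ i ∈ Finset.univ.erase j, 2 / (t j - t i)) - 2 * k / (t j - 1) - (ξ₁ - 1) / t j = 0

/-- The scalar factor of the weight function,
`∑_{σ ∈ S_k} 1 / ((t_σ(1) - t_σ(2)) ⋯ (t_σ(k-1) - t_σ(k)) (t_σ(k) - 1))`. -/
def weightCoeff {k : ℕ} (t : Fin k → ℂ) : ℂ :=
  ∑ σ : Equiv.Perm (Fin k), ∏ s : Fin k,
    1 / (t (σ s) - if hs : s.1 + 1 < k then t (σ ⟨s.1 + 1, hs⟩) else 1)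

/-- The weight function `u(t, Z)` for `Z = 1`, with values in the irreducible module of highest
weight `k α₁`. -/
def weightFunction {k : ℕ} (t : Fin k → ℂ) : Irr (2 * k) :=
  weightCoeff t • act (Irr (2 * k)) (inc f ^ k) (Irr.hwVector (2 * k))

end KZB

end

/-!
The zero weight space of the irreducible module `L` of highest weight `k α₁` is spanned by
`v₀ = f ^ k v_Λ`, so the weight function at a critical point `t` is `c • v₀` for a number `c`, and
two scalars have to be found: `c`, and the scalar product of `ψ_{v₀}` with itself.

The number `c` is `∏ 1 / (t_i - 1)` (`weightCoeff_eq`): split the sum over permutations according to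
the last value and use Lagrange interpolation of the constant `1`. By Stieltjes' argument, the
critical point equations say that `Q = ∏ (x - t_i)` solves a hypergeometric differential equation
with singular points `0`, `1`, `∞` (`coeff_recurrence` is its form as a recurrence of coefficients).
The recurrence at `x = 0` excludes `ξ₁ ∈ {1, …, k}` (`IsCriticalPoint.xi_ne`), and the recurrence at
`x = 1` gives `Q(1) = (2 k)! / (k! (ξ₁ + 1) ⋯ (ξ₁ + k))` (`IsCriticalPoint.prod_one_sub`), hence
`c = (-1) ^ k / Q(1)`.

For the eigenfunction, the exponents `∑_l a_l^σ` are the major indices of the permutations `σ`, so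
MacMahon's formula (`sum_majorIndex`) turns the `j`-th coefficient into `(X / (1 - X)) ^ j`
(`coeffA_eq`). Therefore `ψ_{v₀}(x) = exp(π i ξ₁ x₁) P(Y) v₀` with `Y = X / (X - 1)` and a
hypergeometric polynomial `P` (`psi_eq`). Replacing `x` by `-x` replaces `X` by `X⁻¹` and `Y` by
`1 - Y`, and the exponential factors cancel, so the scalar product is `S(v₀, v₀) = (2 k)!` times the
mean value of `P(Y) P(1 - Y)` on a circle `|X| = r < 1`. Since this function is holomorphic in
`|X| < 1`, its mean value is the one at `X = 0`, namely `P(0) P(1) = P(1)`, and `P(1)` is given by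
the Chu–Vandermonde identity (`chu_vandermonde`, `hypPoly_one`).
-/

noncomputable section

namespace KZB

attribute [local instance 100] LieRing.ofAssociativeRing

/-! ### Permutations by their last value -/

/-- The permutation of `Fin (n + 1)` whose last value is `v` and whose other values are, in order,
those of `τ`, renumbered so as to avoid `v`. -/
def permSnoc {n : ℕ} (v : Fin (n + 1)) (τ : Equiv.Perm (Fin n)) : Equiv.Perm (Fin (n + 1)) :=
  (finSuccEquivLast.trans (Equiv.optionCongr τ)).trans (finSuccEquiv' v).symm

@[simp]
theorem permSnoc_last {n : ℕ} (v : Fin (n + 1)) (τ : Equiv.Perm (Fin n)) :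
    permSnoc v τ (Fin.last n) = v := by
  simp [permSnoc]

@[simp]
theorem permSnoc_castSucc {n : ℕ} (v : Fin (n + 1)) (τ : Equiv.Perm (Fin n)) (i : Fin n) :
    permSnoc v τ i.castSucc = v.succAbove (τ i) := by
  simp [permSnoc]

theorem permSnoc_bijective (n : ℕ) :
    Function.Bijective fun p : Fin (n + 1) × Equiv.Perm (Fin n) => permSnoc p.1 p.2 := by
  rw [Fintype.bijective_iff_injective_and_card]
  refine ⟨?_, by simp [Fintype.card_perm, Nat.factorial_succ]⟩
  rintro ⟨v, τ⟩ ⟨w, ρ⟩ h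
  have hv : v = w := by simpa using Equiv.congr_fun h (Fin.last n)
  subst hv
  have hτ : τ = ρ := by
    ext1 i
    have := Equiv.congr_fun h i.castSucc
    simpa using this
  rw [hτ]

/-- A sum over `S_{n+1}`, split by the last value of the permutation. -/
theorem sum_perm_succ {M : Type*} [AddCommMonoid M] {n : ℕ}
    (F : Equiv.Perm (Fin (n + 1)) → M) :
    ∑ σ, F σ = ∑ v : Fin (n + 1), ∑ τ : Equiv.Perm (Fin n), F (permSnoc v τ) := by
  rw [← Fintype.sum_prod_type', ← (permSnoc_bijective n).sum_comp F]

/-! ### The major index and the operator `A_X` -/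

theorem descentsFrom_permSnoc_last {n : ℕ} (v : Fin (n + 1)) (τ : Equiv.Perm (Fin n)) :
    descentsFrom (permSnoc v τ) (Fin.last n) = 0 := by
  rw [descentsFrom, Finset.card_eq_zero, Finset.filter_eq_empty_iff]
  rintro j - ⟨h1, h2, -⟩
  have := Fin.le_def.1 h1
  simp at this
  omega

theorem descentsFrom_permSnoc_castSucc {n : ℕ} (v : Fin (n + 2))
    (τ : Equiv.Perm (Fin (n + 1))) (i : Fin (n + 1)) :
    descentsFrom (permSnoc v τ) i.castSucc =
      descentsFrom τ i + if v ≤ (τ (Fin.last n)).castSucc then 1 else 0 := by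
  have key : ∀ (m : ℕ) (σ : Equiv.Perm (Fin m)) (k : Fin m), descentsFrom σ k =
      ∑ j : Fin m, if k ≤ j ∧ ∃ hj : j.1 + 1 < m, σ ⟨j.1 + 1, hj⟩ < σ j then 1 else 0 := by
    intro m σ k
    rw [descentsFrom, Finset.card_filter]
  rw [key, key, Fin.sum_univ_castSucc, Fin.sum_univ_castSucc (n := n),
    Fin.sum_univ_castSucc (n := n)]
  have hlast : ¬ ((i.castSucc ≤ Fin.last (n + 1)) ∧ ∃ hj : (Fin.last (n + 1)).1 + 1 < n + 2,
      permSnoc v τ ⟨(Fin.last (n + 1)).1 + 1, hj⟩ < permSnoc v τ (Fin.last (n + 1))) := by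
    rintro ⟨-, h, -⟩
    simp at h
  have hlast' : ¬ ((i ≤ Fin.last n) ∧ ∃ hj : (Fin.last n).1 + 1 < n + 1,
      τ ⟨(Fin.last n).1 + 1, hj⟩ < τ (Fin.last n)) := by
    rintro ⟨-, h, -⟩
    simp at h
  rw [if_neg hlast, if_neg hlast', add_zero, add_zero]
  congr 1
  · refine Finset.sum_congr rfl fun j _ => ?_
    have hj : j.1 + 1 < n + 1 := by omega
    have e1 : (⟨j.castSucc.castSucc.1 + 1, by simp⟩ : Fin (n + 2)) =
        Fin.castSucc ⟨j.1 + 1, hj⟩ := rfl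
    refine if_congr ?_ rfl rfl
    refine and_congr (by simp) ?_
    constructor
    · rintro ⟨h, h'⟩
      refine ⟨hj, ?_⟩
      rw [e1, permSnoc_castSucc, permSnoc_castSucc, Fin.succAbove_lt_succAbove_iff] at h'
      exact h'
    · rintro ⟨h, h'⟩
      refine ⟨by simp, ?_⟩
      rw [e1, permSnoc_castSucc, permSnoc_castSucc, Fin.succAbove_lt_succAbove_iff]
      exact h'
  · have e1 : ∀ hj, (⟨(Fin.last n).castSucc.1 + 1, hj⟩ : Fin (n + 2)) = Fin.last (n + 1) :=
      fun _ => rfl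
    refine if_congr ?_ rfl rfl
    simp only [e1, permSnoc_last, permSnoc_castSucc, Fin.lt_succAbove_iff_le_castSucc]
    constructor
    · rintro ⟨-, -, h⟩
      exact h
    · intro h
      exact ⟨by simpa using Fin.le_last i, by simp, h⟩

/-- The major index of a permutation, the sum of the positions of its descents: a descent at the
position `j` (counted from `0`) is seen from the `j + 1` positions `0, …, j`. -/
def majorIndex {m : ℕ} (σ : Equiv.Perm (Fin m)) : ℕ := ∑ k, descentsFrom σ k

theorem majorIndex_permSnoc {n : ℕ} (v : Fin (n + 2)) (τ : Equiv.Perm (Fin (n + 1))) :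
    majorIndex (permSnoc v τ) =
      majorIndex τ + if v ≤ (τ (Fin.last n)).castSucc then n + 1 else 0 := by
  rw [majorIndex, Fin.sum_univ_castSucc, descentsFrom_permSnoc_last]
  simp only [descentsFrom_permSnoc_castSucc, Finset.sum_add_distrib, majorIndex]
  split_ifs <;> simp

/-- Both sides run over the exponents `n + 1 - v, …, 2 n + 1 - v`. -/
theorem sum_pow_shift (X : ℂ) (n v : ℕ) (hv : v ≤ n + 1) :
    ∑ w ∈ Finset.range (n + 1), X ^ ((n - w) + if v ≤ w then n + 1 else 0) =
      ∑ l ∈ Finset.range (n + 1), X ^ ((n + 1 - v) + l) := by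
  refine Finset.sum_nbij' (fun w => if v ≤ w then n + v - w else v - 1 - w)
    (fun l => if l < v then v - 1 - l else n + v - l) ?_ ?_ ?_ ?_ ?_
  all_goals
    intro a ha
    rw [Finset.mem_range] at ha
    try rw [Finset.mem_range]
    try dsimp only
  · split_ifs <;> omega
  · split_ifs <;> omega
  · split_ifs <;> omega
  · split_ifs <;> omega
  · congr 1
    split_ifs <;> omega

/-- The generating function of the major index over the permutations with a given last value. -/
theorem sum_majorIndex_permSnoc (X : ℂ) (n : ℕ) (v : Fin (n + 1)) :
    ∑ τ : Equiv.Perm (Fin n), X ^ majorIndex (permSnoc v τ) =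
      X ^ (n - v.1) * ∏ i ∈ Finset.range n, ∑ l ∈ Finset.range (i + 1), X ^ l := by
  induction n with
  | zero =>
    simp only [majorIndex, Fin.sum_univ_castSucc, descentsFrom_permSnoc_last]
    simp
  | succ n ih =>
    rw [sum_perm_succ]
    have step : ∀ w : Fin (n + 1), ∑ τ : Equiv.Perm (Fin n),
        X ^ majorIndex (permSnoc v (permSnoc w τ)) =
        X ^ ((n - w.1) + if v.1 ≤ w.1 then n + 1 else 0) *
          ∏ i ∈ Finset.range n, ∑ l ∈ Finset.range (i + 1), X ^ l := by
      intro w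
      simp only [majorIndex_permSnoc v, permSnoc_last, pow_add, ← Finset.sum_mul, ih]
      simp only [Fin.le_def, Fin.val_castSucc]
      ring
    rw [Finset.sum_congr rfl fun w _ => step w, ← Finset.sum_mul,
      Fin.sum_univ_eq_sum_range
        (fun w => X ^ ((n - w) + if v.1 ≤ w then n + 1 else 0)) (n + 1),
      sum_pow_shift X n v.1 (by omega), Finset.prod_range_succ]
    simp only [pow_add, ← Finset.mul_sum]
    ring

/-- MacMahon's formula for the generating function of the major index. -/
theorem sum_majorIndex (X : ℂ) (n : ℕ) :
    ∑ σ : Equiv.Perm (Fin n), X ^ majorIndex σ =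
      ∏ i ∈ Finset.range n, ∑ l ∈ Finset.range (i + 1), X ^ l := by
  rcases n with _ | n
  · simp [majorIndex]
  · rw [sum_perm_succ]
    simp only [sum_majorIndex_permSnoc, ← Finset.sum_mul]
    rw [Finset.prod_range_succ, mul_comm]
    congr 1
    rw [Fin.sum_univ_eq_sum_range (fun w => X ^ (n - w)) (n + 1),
      ← Finset.sum_range_reflect (fun w => X ^ w)]
    simp

/-- Off the roots of unity, `A_X` multiplies `f ^ m` by `(X / (1 - X)) ^ m`: the factors
`X ^ (a_l + 1)` multiply to `X ^ m` times a power with exponent the major index, and the denominators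
cancel against MacMahon's product. -/
theorem coeffA_eq (m : ℕ) (X : ℂ) (hX : ∀ l : ℕ, X ^ (l + 1) ≠ 1) :
    coeffA m X = (X / (1 - X)) ^ m := by
  have h1 : (1 : ℂ) - X ≠ 0 := sub_ne_zero.2 fun h => hX 0 (by simp [← h])
  have hden : ∏ i ∈ Finset.range m, (1 - X ^ (i + 1)) ≠ 0 :=
    Finset.prod_ne_zero_iff.2 fun i _ => sub_ne_zero.2 (hX i).symm
  have hgeom : (∏ i ∈ Finset.range m, ∑ l ∈ Finset.range (i + 1), X ^ l) * (1 - X) ^ m =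
      ∏ i ∈ Finset.range m, (1 - X ^ (i + 1)) := by
    rw [← Finset.card_range m, ← Finset.prod_const, Finset.card_range, ← Finset.prod_mul_distrib]
    exact Finset.prod_congr rfl fun i _ => geom_sum_mul_neg X (i + 1)
  have hterm : ∀ σ : Equiv.Perm (Fin m),
      ∏ k : Fin m, X ^ (descentsFrom σ k + 1) / (1 - X ^ (k.1 + 1)) =
        X ^ majorIndex σ * (X ^ m / ∏ i ∈ Finset.range m, (1 - X ^ (i + 1))) := by
    intro σ
    rw [Finset.prod_div_distrib, Fin.prod_univ_eq_prod_range (fun i => 1 - X ^ (i + 1)) m,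
      Finset.prod_pow_eq_pow_sum, Finset.sum_add_distrib, pow_add, ← majorIndex]
    simp [mul_div_assoc]
  rw [coeffA, Finset.sum_congr rfl fun σ _ => hterm σ, ← Finset.sum_mul, sum_majorIndex, div_pow,
    ← hgeom]
  rw [← hgeom] at hden
  have h2 := left_ne_zero_of_mul hden
  field_simp

/-! ### The scalar factor of the weight function -/

/-- Lagrange interpolation of the constant `1` at the nodes `t_i`, evaluated at `z`. -/
theorem sum_partial_fractions {n : ℕ} (t : Fin (n + 1) → ℂ) (z : ℂ) (ht : Function.Injective t)
    (hz : ∀ i, t i ≠ z) :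
    ∑ v : Fin (n + 1), 1 / (t v - z) * ∏ i : Fin n, 1 / (t (v.succAbove i) - t v) =
      ∏ i, 1 / (t i - z) := by
  have h := congrArg (Polynomial.eval z)
    (Lagrange.sum_basis (s := Finset.univ) (v := t) ht.injOn Finset.univ_nonempty)
  rw [Polynomial.eval_finsetSum, Polynomial.eval_one] at h
  rw [← mul_one (∏ i, 1 / (t i - z)), ← h, Finset.mul_sum]
  refine Finset.sum_congr rfl fun v _ => ?_
  have hb : Polynomial.eval z (Lagrange.basis Finset.univ t v) =
      ∏ i : Fin n, (t v - t (v.succAbove i))⁻¹ * (z - t (v.succAbove i)) := by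
    rw [Lagrange.basis, Polynomial.eval_prod]
    have himg : (Finset.univ : Finset (Fin (n + 1))).erase v =
        (Finset.univ : Finset (Fin n)).map v.succAboveEmb := by
      ext j
      simp [Fin.exists_succAbove_eq_iff]
    rw [himg, Finset.prod_map]
    simp [Lagrange.basisDivisor]
  rw [hb, Fin.prod_univ_succAbove _ v, mul_assoc, ← Finset.prod_mul_distrib]
  congr 1
  refine Finset.prod_congr rfl fun i _ => ?_
  have h1 : t (v.succAbove i) - z ≠ 0 := sub_ne_zero.2 (hz _)
  have h2 : t (v.succAbove i) - t v ≠ 0 := sub_ne_zero.2 fun h => Fin.succAbove_ne v i (ht h)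
  have h3 : t v - t (v.succAbove i) ≠ 0 := sub_ne_zero.2 fun h => Fin.succAbove_ne v i (ht h.symm)
  field_simp
  ring

/-- The weight function with a variable base point `z` in place of `1`, which makes an induction
on the number of variables possible: the last variable is the base point of the others. -/
theorem sum_perm_chain {k : ℕ} (t : Fin k → ℂ) (z : ℂ) (ht : Function.Injective t)
    (hz : ∀ i, t i ≠ z) :
    ∑ σ : Equiv.Perm (Fin k), ∏ s : Fin k,
      1 / (t (σ s) - if hs : s.1 + 1 < k then t (σ ⟨s.1 + 1, hs⟩) else z) =
      ∏ i, 1 / (t i - z) := by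
  induction k generalizing z with
  | zero => simp
  | succ n ih =>
    rw [sum_perm_succ, ← sum_partial_fractions t z ht hz]
    refine Finset.sum_congr rfl fun v _ => ?_
    have hv := ih (t ∘ v.succAbove) (t v) (ht.comp Fin.succAbove_right_injective)
      fun i h => Fin.succAbove_ne v i (ht h)
    simp only [Function.comp_apply] at hv
    rw [← hv, Finset.mul_sum]
    refine Finset.sum_congr rfl fun τ _ => ?_
    rw [Fin.prod_univ_castSucc, mul_comm]
    congr 1
    · simp
    · refine Finset.prod_congr rfl fun s _ => ?_
      have hs : s.castSucc.1 + 1 < n + 1 := by simp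
      rw [dif_pos hs, permSnoc_castSucc]
      by_cases h : s.1 + 1 < n
      · have : (⟨s.castSucc.1 + 1, hs⟩ : Fin (n + 1)) = Fin.castSucc ⟨s.1 + 1, h⟩ := rfl
        rw [dif_pos h, this, permSnoc_castSucc]
      · have : (⟨s.castSucc.1 + 1, hs⟩ : Fin (n + 1)) = Fin.last n := by
          ext
          simp
          omega
        rw [dif_neg h, this, permSnoc_last]

theorem weightCoeff_eq {k : ℕ} (t : Fin k → ℂ) (ht : Function.Injective t) (h1 : ∀ i, t i ≠ 1) :
    weightCoeff t = ∏ i, 1 / (t i - 1) :=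
  sum_perm_chain t 1 ht h1

/-! ### Products and the Chu–Vandermonde identity -/

theorem prod_Icc_one (g : ℕ → ℂ) (k : ℕ) :
    ∏ j ∈ Finset.Icc 1 k, g j = ∏ i ∈ Finset.range k, g (i + 1) := by
  induction k with
  | zero => simp
  | succ k ih => rw [Finset.prod_Icc_succ_top (by omega), ih, Finset.prod_range_succ]

theorem prod_range_add_one (k : ℕ) : ∏ i ∈ Finset.range k, ((i : ℂ) + 1) = (k ! : ℂ) := by
  rw [← Finset.prod_range_add_one_eq_factorial]
  push_cast
  rfl

theorem prod_range_sub (k j : ℕ) :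
    ∏ i ∈ Finset.range j, ((k : ℂ) - i) = (k.choose j : ℂ) * (j ! : ℂ) := by
  induction j with
  | zero => simp
  | succ j ih =>
    have h : (k.choose (j + 1) : ℂ) * (j + 1) = k.choose j * (k - j) := by
      rcases le_or_gt j k with hj | hj
      · have := congrArg (Nat.cast (R := ℂ)) (Nat.choose_succ_right_eq k j)
        rwa [Nat.cast_mul, Nat.cast_mul, Nat.cast_sub hj, Nat.cast_succ] at this
      · rw [Nat.choose_eq_zero_of_lt hj, Nat.choose_eq_zero_of_lt (hj.trans j.lt_succ_self)]
        simp
    rw [Finset.prod_range_succ, ih, Nat.factorial_succ]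
    push_cast
    linear_combination -(j ! : ℂ) * h

theorem factorial_mul_prod_range (k : ℕ) :
    (k ! : ℂ) * ∏ i ∈ Finset.range k, ((k : ℂ) + 1 + i) = ((2 * k)! : ℂ) := by
  rw [two_mul, ← Nat.factorial_mul_ascFactorial, Nat.ascFactorial_eq_prod_range]
  push_cast
  rfl

/-- The Chu–Vandermonde identity `∑_j (-1)^j C(n, j) (b)_j (c + j)_{n - j} = (c - b)_n`. -/
theorem chu_vandermonde (n : ℕ) (b c : ℂ) :
    ∑ j ∈ Finset.range (n + 1), (n.choose j : ℂ) * ((-1) ^ j * (∏ i ∈ Finset.range j, (b + i)) *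
      ∏ i ∈ Finset.range (n - j), (c + j + i)) = ∏ i ∈ Finset.range n, (c - b + i) := by
  induction n generalizing b c with
  | zero => simp
  | succ n ih =>
    have key := Finset.sum_choose_succ_mul (R := ℂ)
      (fun j m => (-1) ^ j * (∏ i ∈ Finset.range j, (b + i)) *
        ∏ i ∈ Finset.range m, (c + j + i)) n
    have h1 : ∑ j ∈ Finset.range (n + 1), (n.choose j : ℂ) * ((-1) ^ j *
        (∏ i ∈ Finset.range j, (b + i)) * ∏ i ∈ Finset.range (n + 1 - j), (c + j + i)) =
        (c + n) * ∏ i ∈ Finset.range n, (c - b + i) := by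
      rw [← ih b c, Finset.mul_sum]
      refine Finset.sum_congr rfl fun j hj => ?_
      have hjn : j ≤ n := Nat.lt_succ_iff.1 (Finset.mem_range.1 hj)
      rw [Nat.succ_sub hjn, Finset.prod_range_succ, Nat.cast_sub hjn]
      ring
    have h2 : ∑ j ∈ Finset.range (n + 1), (n.choose j : ℂ) * ((-1) ^ (j + 1) *
        (∏ i ∈ Finset.range (j + 1), (b + i)) *
          ∏ i ∈ Finset.range (n - j), (c + (j + 1 : ℕ) + i)) =
        -b * ∏ i ∈ Finset.range n, (c - b + i) := by
      have h3 := ih (b + 1) (c + 1)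
      rw [show c + 1 - (b + 1) = c - b by ring] at h3
      rw [← h3, Finset.mul_sum]
      refine Finset.sum_congr rfl fun j _ => ?_
      have e1 : ∏ i ∈ Finset.range (j + 1), (b + i) = (∏ i ∈ Finset.range j, (b + 1 + i)) * b := by
        rw [Finset.prod_range_succ', Nat.cast_zero, add_zero]
        congr 1
        exact Finset.prod_congr rfl fun i _ => by push_cast; ring
      have e2 : ∏ i ∈ Finset.range (n - j), (c + (j + 1 : ℕ) + i) =
          ∏ i ∈ Finset.range (n - j), (c + 1 + j + i) :=
        Finset.prod_congr rfl fun i _ => by push_cast; ring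
      rw [e1, e2]
      ring
    rw [key, h1, h2, Finset.prod_range_succ]
    ring

/-- The value at `1` of the hypergeometric polynomial that represents the eigenfunction. -/
theorem sum_choose_eq (k : ℕ) (ξ : ℂ) :
    ∑ j ∈ Finset.range (k + 1), (k.choose j : ℂ) * ((∏ i ∈ Finset.range j, ((k : ℂ) + 1 + i)) *
      ∏ i ∈ Finset.range (k - j), (ξ - 1 - j - i)) = ∏ i ∈ Finset.range k, (ξ + 1 + i) := by
  have neg_prod : ∀ (g : ℕ → ℂ) (m : ℕ),
      ∏ i ∈ Finset.range m, -g i = (-1) ^ m * ∏ i ∈ Finset.range m, g i := by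
    intro g m
    rw [Finset.prod_neg, Finset.card_range]
  have h := chu_vandermonde k (k + 1) (1 - ξ)
  have hr : ∏ i ∈ Finset.range k, (1 - ξ - (k + 1) + i) =
      (-1) ^ k * ∏ i ∈ Finset.range k, (ξ + 1 + i) := by
    rw [← Finset.prod_range_reflect (fun i => ξ + 1 + (i : ℂ)), ← neg_prod]
    refine Finset.prod_congr rfl fun i hi => ?_
    have : ((k - 1 - i : ℕ) : ℂ) = k - 1 - i := by
      have := Finset.mem_range.1 hi
      rw [Nat.cast_sub (by omega), Nat.cast_sub (by omega), Nat.cast_one]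
    rw [this]
    ring
  have hl : ∀ j ∈ Finset.range (k + 1),
      (k.choose j : ℂ) * ((-1) ^ j * (∏ i ∈ Finset.range j, ((k : ℂ) + 1 + i)) *
        ∏ i ∈ Finset.range (k - j), (1 - ξ + j + i)) =
      (-1) ^ k * ((k.choose j : ℂ) * ((∏ i ∈ Finset.range j, ((k : ℂ) + 1 + i)) *
        ∏ i ∈ Finset.range (k - j), (ξ - 1 - j - i))) := by
    intro j hj
    have e : ∏ i ∈ Finset.range (k - j), (1 - ξ + j + i) =
        (-1) ^ (k - j) * ∏ i ∈ Finset.range (k - j), (ξ - 1 - j - i) := by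
      rw [← neg_prod]
      exact Finset.prod_congr rfl fun i _ => by ring
    have hs : (-1 : ℂ) ^ k = (-1) ^ j * (-1) ^ (k - j) := by
      rw [← pow_add, Nat.add_sub_cancel' (Nat.lt_succ_iff.1 (Finset.mem_range.1 hj))]
    rw [e, hs]
    ring
  rw [hr, Finset.sum_congr rfl hl, ← Finset.mul_sum] at h
  exact mul_left_cancel₀ (pow_ne_zero _ (by norm_num)) h

/-! ### The polynomial with the coordinates of a critical point as roots -/

open Polynomial in
theorem coeff_X_mul_derivative (p : ℂ[X]) (n : ℕ) :
    (X * derivative p).coeff n = n * p.coeff n := by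
  rcases n with _ | n
  · simp
  · rw [coeff_X_mul, coeff_derivative]
    push_cast
    ring

open Polynomial in
/-- At a root `t_j` of a polynomial `Q` with simple roots `t_i`, the quotient `Q'' / Q'` is
`∑_{i ≠ j} 2 / (t_j - t_i)`. -/
theorem eval_derivative_derivative {k : ℕ} (t : Fin k → ℂ) (ht : Function.Injective t)
    (j : Fin k) :
    (derivative (derivative (∏ i, (X - C (t i))))).eval (t j) =
      (derivative (∏ i, (X - C (t i)))).eval (t j) *
        ∑ i ∈ Finset.univ.erase j, 2 / (t j - t i) := by
  set G : ℂ[X] := ∏ i ∈ Finset.univ.erase j, (X - C (t i)) with hG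
  have hQ : ∏ i, (X - C (t i)) = (X - C (t j)) * G :=
    (Finset.mul_prod_erase _ _ (Finset.mem_univ j)).symm
  have hG' : (derivative G).eval (t j) =
      G.eval (t j) * ∑ i ∈ Finset.univ.erase j, 1 / (t j - t i) := by
    rw [hG, derivative_prod_finset, eval_finsetSum, Finset.mul_sum]
    refine Finset.sum_congr rfl fun i hi => ?_
    have hij : t j - t i ≠ 0 := sub_ne_zero.2 fun h => (Finset.mem_erase.1 hi).1 (ht h).symm
    rw [← Finset.mul_prod_erase _ (fun i => X - C (t i)) hi]
    simp only [derivative_sub, derivative_X, derivative_C, sub_zero, mul_one, eval_mul, eval_sub,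
      eval_X, eval_C]
    field_simp
  have h2 : ∑ i ∈ Finset.univ.erase j, 2 / (t j - t i) =
      2 * ∑ i ∈ Finset.univ.erase j, 1 / (t j - t i) := by
    rw [Finset.mul_sum]
    exact Finset.sum_congr rfl fun i _ => by ring
  rw [hQ, h2]
  simp only [derivative_mul, derivative_sub, derivative_X, derivative_C, sub_zero, one_mul,
    derivative_add, eval_add, eval_mul, eval_sub, eval_X, eval_C, sub_self, zero_mul, hG']
  ring

open Polynomial in
/-- Stieltjes' argument: if `t_j (t_j + c) ∑_{i ≠ j} 2 / (t_j - t_i) = A t_j + B` for all `j`, then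
`Q = ∏ (x - t_j)` satisfies `x (x + c) Q'' - (A x + B) Q' + (A k - k (k - 1)) Q = 0`, since the left
side has degree less than `k` and vanishes at the `k` points `t_j`. This is the resulting
recurrence for the coefficients of `Q`. -/
theorem coeff_recurrence {k : ℕ} (t : Fin k → ℂ) (ht : Function.Injective t) (A B c : ℂ)
    (h : ∀ j, t j * (t j + c) * ∑ i ∈ Finset.univ.erase j, 2 / (t j - t i) = A * t j + B) (n : ℕ) :
    (n * (n - 1) - A * n + (A * k - k * (k - 1))) * (∏ i, (X - C (t i))).coeff n +
      (n + 1) * (c * n - B) * (∏ i, (X - C (t i))).coeff (n + 1) = 0 := by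
  set Q : ℂ[X] := ∏ i, (X - C (t i)) with hQ
  set R : ℂ[X] := (X * derivative (X * derivative Q) - X * derivative Q) +
    C c * (derivative (X * derivative Q) - derivative Q) - C A * (X * derivative Q) -
      C B * derivative Q + C (A * k - k * (k - 1)) * Q with hR
  have hcoeff : ∀ n : ℕ, R.coeff n =
      (n * (n - 1) - A * n + (A * k - k * (k - 1))) * Q.coeff n +
        (n + 1) * (c * n - B) * Q.coeff (n + 1) := by
    intro n
    simp only [hR, coeff_add, coeff_sub, coeff_C_mul, coeff_X_mul_derivative, coeff_derivative]
    push_cast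
    ring
  have hdeg : Q.natDegree = k := by
    rw [hQ, natDegree_finsetProd_X_sub_C_eq_card, Finset.card_univ, Fintype.card_fin]
  have hR0 : R = 0 := by
    refine eq_zero_of_degree_lt_of_eval_index_eq_zero (v := t) (s := Finset.univ) ht.injOn ?_ ?_
    · rw [Finset.card_univ, Fintype.card_fin, degree_lt_iff_coeff_zero]
      intro m hm
      rw [hcoeff, coeff_eq_zero_of_natDegree_lt (n := m + 1) (by omega)]
      rcases hm.eq_or_lt with rfl | hm
      · ring
      · rw [coeff_eq_zero_of_natDegree_lt (by omega)]
        ring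
    · intro j _
      have hj : Q.eval (t j) = 0 := by
        rw [hQ, eval_prod]
        exact Finset.prod_eq_zero (Finset.mem_univ j) (by simp)
      have hd := eval_derivative_derivative t ht j
      rw [← hQ] at hd
      simp only [hR, derivative_mul, derivative_X, eval_add, eval_sub, eval_mul, eval_X, eval_C,
        eval_one, hj, hd]
      linear_combination (derivative Q).eval (t j) * h j
  rw [← hcoeff, hR0, coeff_zero]

open Polynomial in
theorem coeff_prod_X_sub_C {k : ℕ} (t : Fin k → ℂ) : (∏ i, (X - C (t i))).coeff k = 1 := by
  have h1 : (∏ i, (X - C (t i))).Monic := monic_prod_of_monic _ _ fun i _ => monic_X_sub_C _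
  have h2 : (∏ i, (X - C (t i))).natDegree = k := by
    rw [natDegree_finsetProd_X_sub_C_eq_card, Finset.card_univ, Fintype.card_fin]
  have h3 := h1.coeff_natDegree
  rwa [h2] at h3

open Polynomial in
theorem coeff_zero_prod_X_sub_C {k : ℕ} (t : Fin k → ℂ) :
    (∏ i, (X - C (t i))).coeff 0 = ∏ i, -t i := by
  rw [coeff_zero_eq_eval_zero, eval_prod]
  simp

section CriticalPoints

variable {k : ℕ} {ξ₁ : ℂ} {t : Fin k → ℂ}

/-- The recurrence of the coefficients of `∏ (x - t_j)` at `x = 0` excludes `ξ₁ ∈ {1, …, k}`: for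
`ξ₁ = m` it forces the coefficients with indices `m - 1, …, 0` to vanish, but the last one is
`∏ (-t_j)`. -/
theorem IsCriticalPoint.xi_ne (ht : IsCriticalPoint k ξ₁ t) (m : ℕ) (hm : m < k) :
    ξ₁ ≠ (m : ℂ) + 1 := by
  intro hξ
  have hrec := coeff_recurrence t ht.injective (2 * k + ξ₁ - 1) (-(ξ₁ - 1)) (-1) (fun j => by
    have h0 := ht.ne_zero j
    have h1 := sub_ne_zero.2 (ht.ne_one j)
    have he := ht.eqn j
    rw [sub_sub, sub_eq_zero] at he
    rw [he, ← sub_eq_add_neg]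
    field_simp
    ring)
  have hne : ∀ n : ℕ, n ≤ m → ((n : ℂ) * (n - 1) - (2 * k + ξ₁ - 1) * n +
      ((2 * k + ξ₁ - 1) * k - k * (k - 1))) ≠ 0 := by
    intro n hn h0
    have h1 : ((n : ℂ) - k) * (n - k - m - 1) = 0 := by
      rw [hξ] at h0
      linear_combination h0
    rcases mul_eq_zero.1 h1 with h | h
    · have : (n : ℂ) = k := by linear_combination h
      have := Nat.cast_injective this
      omega
    · have : (n : ℂ) = ((k + m + 1 : ℕ) : ℂ) := by push_cast; linear_combination h
      have := Nat.cast_injective this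
      omega
  have hz : ∀ d : ℕ, d ≤ m → (∏ i, (Polynomial.X - Polynomial.C (t i))).coeff (m - d) = 0 := by
    intro d
    induction d with
    | zero =>
      intro _
      have h := hrec m
      rw [show (-1 * (m : ℂ) - -(ξ₁ - 1)) = 0 by rw [hξ]; ring, mul_zero, zero_mul, add_zero] at h
      exact (mul_eq_zero.1 h).resolve_left (hne m le_rfl)
    | succ d ih =>
      intro hd
      have h := hrec (m - (d + 1))
      rw [show m - (d + 1) + 1 = m - d by omega, ih (by omega), mul_zero, add_zero] at h
      exact (mul_eq_zero.1 h).resolve_left (hne _ (by omega))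
  have h0 := hz m le_rfl
  rw [Nat.sub_self, coeff_zero_prod_X_sub_C] at h0
  obtain ⟨i, -, hi⟩ := Finset.prod_eq_zero_iff.1 h0
  exact ht.ne_zero i (neg_eq_zero.1 hi)

/-- The recurrence of the coefficients of `∏ (x - t_j)` at `x = 1` determines `∏ (1 - t_j)`. -/
theorem IsCriticalPoint.prod_one_sub (ht : IsCriticalPoint k ξ₁ t) :
    (∏ i, (1 - t i)) * (k ! * ∏ i ∈ Finset.range k, (ξ₁ + 1 + i)) = (2 * k)! := by
  have hinj : Function.Injective fun i => t i - 1 := fun i j h => ht.injective (by simpa using h)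
  have hrec := coeff_recurrence (fun i => t i - 1) hinj (2 * k + ξ₁ - 1) (2 * k) 1 (fun j => by
    have h0 := ht.ne_zero j
    have h1 := sub_ne_zero.2 (ht.ne_one j)
    have he := ht.eqn j
    rw [sub_sub, sub_eq_zero] at he
    simp only [sub_sub_sub_cancel_right, he, sub_add_cancel]
    field_simp
    ring)
  set q := ∏ i, (Polynomial.X - Polynomial.C (t i - 1)) with hq
  have hstep : ∀ n : ℕ, ((k : ℂ) - n) * (ξ₁ + k - n) * q.coeff n =
      (n + 1) * (2 * k - n) * q.coeff (n + 1) := by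
    intro n
    linear_combination hrec n
  -- The recurrence multiplied over the top `d` indices.
  have hall : ∀ d : ℕ, d ≤ k →
      q.coeff (k - d) * (∏ i ∈ Finset.range d, ((i : ℂ) + 1) * (ξ₁ + 1 + i)) =
        ∏ i ∈ Finset.range d, ((k : ℂ) - i) * (k + 1 + i) := by
    intro d
    induction d with
    | zero =>
      intro _
      rw [Finset.range_zero, Finset.prod_empty, Finset.prod_empty, mul_one, Nat.sub_zero]
      exact coeff_prod_X_sub_C fun i => t i - 1
    | succ d ih =>
      intro hd
      have h := hstep (k - (d + 1))
      rw [show k - (d + 1) + 1 = k - d by omega, Nat.cast_sub hd] at h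
      push_cast at h
      rw [Finset.prod_range_succ, Finset.prod_range_succ, ← ih (by omega)]
      linear_combination (∏ i ∈ Finset.range d, ((i : ℂ) + 1) * (ξ₁ + 1 + i)) * h
  have h := hall k le_rfl
  rw [Nat.sub_self, hq, coeff_zero_prod_X_sub_C, Finset.prod_mul_distrib,
    Finset.prod_mul_distrib] at h
  have e2 := prod_range_sub k k
  rw [Nat.choose_self, Nat.cast_one, one_mul] at e2
  rw [prod_range_add_one, e2, factorial_mul_prod_range] at h
  rw [← h]
  congr 1
  exact Finset.prod_congr rfl fun i _ => by ring

end CriticalPoints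

/-! ### The irreducible module and its zero weight space -/

/-- The image of `f ^ j 1_μ` in `L_μ`; it may vanish. -/
def Irr.vec (μ : ℂ) (j : ℕ) : Irr μ := LieSubmodule.Quotient.mk (Verma.basis μ j)

theorem Irr.lie_vec (μ : ℂ) (x : sl2) (j : ℕ) :
    ⁅x, Irr.vec μ j⁆ = LieSubmodule.Quotient.mk ⁅x, Verma.basis μ j⁆ :=
  rfl

theorem Irr.act_e_vec (μ : ℂ) (j : ℕ) :
    act (Irr μ) (inc e) (Irr.vec μ j) = ((j : ℂ) * (μ - j + 1)) • Irr.vec μ (j - 1) := by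
  rw [act_inc, Irr.lie_vec, Verma.e_lie, Verma.opE_basis]
  rfl

theorem Irr.act_f_vec (μ : ℂ) (j : ℕ) :
    act (Irr μ) (inc f) (Irr.vec μ j) = Irr.vec μ (j + 1) := by
  rw [act_inc, Irr.lie_vec, Verma.f_lie, Verma.opF_basis]
  rfl

theorem Irr.h_lie_vec (μ : ℂ) (j : ℕ) : ⁅h, Irr.vec μ j⁆ = (μ - 2 * j) • Irr.vec μ j := by
  rw [Irr.lie_vec, Verma.h_lie, Verma.opH_basis]
  rfl

theorem Irr.act_f_pow_vec (μ : ℂ) (n j : ℕ) :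
    act (Irr μ) (inc f ^ n) (Irr.vec μ j) = Irr.vec μ (j + n) := by
  induction n with
  | zero => simp
  | succ n ih => rw [pow_succ', map_mul, Module.End.mul_apply, ih, Irr.act_f_vec, add_assoc]

/-- For `n > m` both sides vanish: the factor with `i = m` of the product is `0`. -/
theorem Irr.act_e_pow_vec (μ : ℂ) (n m : ℕ) :
    act (Irr μ) (inc e ^ n) (Irr.vec μ m) =
      (∏ i ∈ Finset.range n, ((m : ℂ) - i) * (μ - m + 1 + i)) • Irr.vec μ (m - n) := by
  induction n with
  | zero => simp
  | succ n ih =>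
    rw [pow_succ', map_mul, Module.End.mul_apply, ih, map_smul, Irr.act_e_vec, smul_smul,
      Finset.prod_range_succ, Nat.sub_sub]
    rcases le_or_gt n m with h | h
    · rw [Nat.cast_sub h]
      congr 2
      ring
    · rw [Finset.prod_eq_zero (Finset.mem_range.2 h) (by ring), zero_mul, zero_mul]

theorem form_basis_self (μ : ℂ) (j : ℕ) :
    Verma.form μ (Verma.basis μ j) (Verma.basis μ j) =
      ∏ i ∈ Finset.range j, ((i : ℂ) + 1) * (μ - i) := by
  induction j with
  | zero => simp [form_basis, dualOne_basis]
  | succ j ih =>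
    rw [form_basis_succ_succ, ih, Finset.prod_range_succ, mul_comm]
    congr 1
    push_cast
    ring

theorem shapovalovU_f_pow (μ : ℂ) (j : ℕ) :
    shapovalovU μ (inc f ^ j) (inc f ^ j) = ∏ i ∈ Finset.range j, ((i : ℂ) + 1) * (μ - i) := by
  rw [← form_basis_self, Verma.form, Module.Basis.constr_basis, Module.Basis.constr_basis]

theorem chevalley_f_pow (j : ℕ) : chevalley (inc f ^ j) = (-1 : ℂ) ^ j • inc e ^ j := by
  have h1 : chevalley (inc f) = -inc e := by
    simp [chevalley, inc, chevalleyLie_f]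
  rw [map_pow, h1, ← neg_one_smul ℂ (inc e), smul_pow]

theorem weightFunction_eq {k : ℕ} (t : Fin k → ℂ) :
    weightFunction t = weightCoeff t • Irr.vec (2 * k) k := by
  have h0 : Irr.hwVector (2 * k) = Irr.vec (2 * k) 0 := rfl
  rw [weightFunction, h0, Irr.act_f_pow_vec, zero_add]

theorem antipode_e_pow (n : ℕ) : antipode (inc e ^ n) = (-1 : ℂ) ^ n • inc e ^ n := by
  induction n with
  | zero => simp [antipode]
  | succ n ih =>
    rw [pow_succ, antipode_mul, ih, antipode_inc, ← pow_succ, pow_succ' (-1 : ℂ),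
      pow_succ' (inc e)]
    simp

theorem antipode_sum {ι : Type*} (s : Finset ι) (a : ι → ℂ) (g : ι → U) :
    antipode (∑ i ∈ s, a i • g i) = ∑ i ∈ s, a i • antipode (g i) := by
  simp [antipode]

/-- If `μ ∉ {0, …, k - 1}`, then an element `∑ p_n e ^ n` of the ideal `I_μ` has `p_n = 0` for
`n ≤ k`, since its values on `f ^ n 1_μ` are `± p_n S_μ(f ^ n, f ^ n)`. -/
theorem coeff_eq_zero_of_mem_annIdeal {μ : ℂ} {k : ℕ} (hμ : ∀ i < k, μ ≠ (i : ℂ))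
    {p : Polynomial ℂ} (hp : p.sum (fun n a => a • inc e ^ n) ∈ annIdeal μ) {m : ℕ} (hm : m ≤ k) :
    p.coeff m = 0 := by
  have hact : act (Verma μ) (inc e) = Verma.opE μ := by
    ext x
    rw [act_inc, Verma.e_lie]
  have h := hp.2 (Verma.basis μ m)
  rw [Polynomial.sum, antipode_sum] at h
  simp only [antipode_e_pow, map_sum, map_smul, LinearMap.sum_apply, LinearMap.smul_apply, map_pow,
    hact, ← form_basis, smul_eq_mul] at h
  rw [Finset.sum_eq_single m] at h
  · rw [form_basis_self] at h
    have h1 : ∏ i ∈ Finset.range m, ((i : ℂ) + 1) * (μ - i) ≠ 0 :=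
      Finset.prod_ne_zero_iff.2 fun i hi => mul_ne_zero (Nat.cast_add_one_ne_zero i)
        (sub_ne_zero.2 (hμ i ((Finset.mem_range.1 hi).trans_le hm)))
    have h2 : (-1 : ℂ) ^ m ≠ 0 := pow_ne_zero _ (by norm_num)
    simpa [h1, h2] using h
  · intro n _ hn
    rw [form_basis_ne _ _ _ hn, mul_zero, mul_zero]
  · intro hm
    rw [Polynomial.notMem_support_iff.1 hm, zero_mul]

theorem vec_mem_zeroWeightAnn {μ : ℂ} {k : ℕ} (hμ : ∀ i < k, μ ≠ (i : ℂ)) :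
    Irr.vec (2 * k) k ∈ zeroWeightAnn (Irr (2 * k)) μ := by
  refine ⟨?_, fun E hE => ?_⟩
  · rw [zeroWeight, LinearMap.mem_ker, LieModule.toEnd_apply_apply, Irr.h_lie_vec, sub_self,
      zero_smul]
  · obtain ⟨p, rfl⟩ : ∃ p : Polynomial ℂ, p.sum (fun n a => a • inc e ^ n) = E := by
      have h := hE.1
      rw [Algebra.adjoin_singleton_eq_range_aeval] at h
      obtain ⟨p, rfl⟩ := h
      exact ⟨p, by
        simp [Polynomial.aeval_def, Polynomial.eval₂_eq_sum, Algebra.smul_def]⟩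
    rw [Polynomial.sum, map_sum, LinearMap.sum_apply]
    refine Finset.sum_eq_zero fun n _ => ?_
    rw [map_smul, LinearMap.smul_apply, Irr.act_e_pow_vec]
    rcases le_or_gt n k with h | h
    · rw [coeff_eq_zero_of_mem_annIdeal hμ hE h, zero_smul]
    · rw [Finset.prod_eq_zero (Finset.mem_range.2 h) (by ring), zero_smul, smul_zero]

/-! ### The eigenfunction -/

/-- The hypergeometric polynomial `∑_j C(k, j) (k + 1)_j / ((ξ₁ - 1) ⋯ (ξ₁ - j)) Y ^ j`. -/
def hypPoly (k : ℕ) (ξ₁ Y : ℂ) : ℂ :=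
  ∑ j ∈ Finset.range (k + 1), (k.choose j : ℂ) * (∏ i ∈ Finset.range j, ((k : ℂ) + 1 + i)) /
    (∏ i ∈ Finset.range j, (ξ₁ - 1 - i)) * Y ^ j

theorem hypPoly_zero (k : ℕ) (ξ₁ : ℂ) : hypPoly k ξ₁ 0 = 1 := by
  rw [hypPoly, Finset.sum_range_succ']
  simp

theorem hypPoly_one {k : ℕ} {ξ₁ : ℂ} (hξ : ∀ i < k, ξ₁ - 1 ≠ (i : ℂ)) :
    hypPoly k ξ₁ 1 =
      (∏ i ∈ Finset.range k, (ξ₁ + 1 + i)) / ∏ i ∈ Finset.range k, (ξ₁ - 1 - i) := by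
  have hne : ∀ j ≤ k, ∏ i ∈ Finset.range j, (ξ₁ - 1 - i) ≠ 0 := fun j hj =>
    Finset.prod_ne_zero_iff.2 fun i hi =>
      sub_ne_zero.2 (hξ i ((Finset.mem_range.1 hi).trans_le hj))
  rw [eq_div_iff (hne k le_rfl), ← sum_choose_eq, hypPoly, Finset.sum_mul]
  refine Finset.sum_congr rfl fun j hj => ?_
  have hjk : j ≤ k := Nat.lt_succ_iff.1 (Finset.mem_range.1 hj)
  have hsplit : ∏ i ∈ Finset.range k, (ξ₁ - 1 - i) = (∏ i ∈ Finset.range j, (ξ₁ - 1 - i)) *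
      ∏ i ∈ Finset.range (k - j), (ξ₁ - 1 - j - i) := by
    conv_lhs => rw [← Nat.add_sub_cancel' hjk, Finset.prod_range_add]
    congr 1
    exact Finset.prod_congr rfl fun i _ => by push_cast; ring
  have := hne j hjk
  rw [hsplit, one_pow]
  field_simp

theorem act_f_pow_xiComponent (k : ℕ) (ξ₁ c : ℂ) (j : ℕ) :
    act (Irr (2 * k)) (inc f ^ j) (xiComponent (ξ₁ - 1) (c • Irr.vec (2 * k) k) j) =
      (c * ((-1) ^ j * ((k.choose j : ℂ) * (∏ i ∈ Finset.range j, ((k : ℂ) + 1 + i)) /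
        (∏ i ∈ Finset.range j, (ξ₁ - 1 - i))))) • Irr.vec (2 * k) k := by
  rw [xiComponent, chevalley_f_pow, shapovalovU_f_pow, map_smul (act (Irr (2 * k))),
    LinearMap.smul_apply, map_smul (act (Irr (2 * k)) (inc e ^ j)), Irr.act_e_pow_vec]
  simp only [map_smul, smul_smul, Irr.act_f_pow_vec]
  have hfac : ∏ i ∈ Finset.range j, ((i : ℂ) + 1) ≠ 0 :=
    Finset.prod_ne_zero_iff.2 fun i _ => Nat.cast_add_one_ne_zero i
  have hE : ∏ i ∈ Finset.range j, ((k : ℂ) - i) * (2 * k - k + 1 + i) =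
      (k.choose j : ℂ) * (∏ i ∈ Finset.range j, ((i : ℂ) + 1)) *
        ∏ i ∈ Finset.range j, ((k : ℂ) + 1 + i) := by
    rw [Finset.prod_mul_distrib, prod_range_sub, prod_range_add_one]
    congr 1
    exact Finset.prod_congr rfl fun i _ => by ring
  rw [hE, Finset.prod_mul_distrib, mul_inv]
  rcases le_or_gt j k with h | h
  · rw [Nat.sub_add_cancel h]
    congr 1
    field_simp
  · rw [Nat.choose_eq_zero_of_lt h]
    simp

/-- For `X` off the unit circle, `A_X(f ^ j) = (X / (1 - X)) ^ j f ^ j`, and the eigenfunction is a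
hypergeometric polynomial in `X / (X - 1)`. -/
theorem psi_eq (k : ℕ) (ξ₁ c x : ℂ) {X : ℂ} (hX : Complex.exp (-2 * Real.pi * Complex.I * x) = X)
    (h1 : ‖X‖ ≠ 1) :
    psi ξ₁ (c • Irr.vec (2 * k) k) x =
      (Complex.exp (Real.pi * Complex.I * ξ₁ * x) * (c * hypPoly k ξ₁ (X / (X - 1)))) •
        Irr.vec (2 * k) k := by
  have hpow : ∀ l : ℕ, X ^ (l + 1) ≠ 1 := fun l h => by
    have h2 := congrArg norm h
    rw [norm_pow, norm_one] at h2
    exact h1 ((pow_eq_one_iff_of_nonneg (norm_nonneg X) l.succ_ne_zero).1 h2)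
  have hX' : X / (X - 1) = -(X / (1 - X)) := by rw [← neg_sub 1 X, div_neg]
  rw [psi, hX]
  simp only [act_f_pow_xiComponent, coeffA_eq _ X hpow, smul_smul]
  rw [finsum_eq_sum_of_support_subset (s := Finset.range (k + 1)), ← Finset.sum_smul, smul_smul]
  · congr 2
    rw [hypPoly, Finset.mul_sum]
    refine Finset.sum_congr rfl fun j _ => ?_
    rw [hX', neg_pow (X / (1 - X))]
    ring
  · intro j hj
    rw [Finset.coe_range, Set.mem_Iio]
    by_contra hjk
    refine hj ?_
    simp only [Nat.choose_eq_zero_of_lt (show k < j by omega)]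
    simp

theorem form_vec (k : ℕ) :
    Irr.form (2 * k) (Irr.vec (2 * k) k) (Irr.vec (2 * k) k) = ((2 * k)! : ℂ) := by
  have h := prod_range_sub (2 * k) k
  push_cast at h
  rw [Irr.vec, Irr.form_mk, form_basis_self, Finset.prod_mul_distrib, prod_range_add_one, h,
    ← Nat.choose_mul_factorial_mul_factorial (show k ≤ 2 * k by omega),
    show 2 * k - k = k by omega]
  push_cast
  ring

/-! ### The scalar product -/

/-- The mean value property in the coordinate `x₁`: along the segment the function `e^{-2πi x₁}`
runs once through the circle of radius `e^{-2πδ}`. -/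
theorem integral_exp_eq (G : ℂ → ℂ) (hG : DifferentiableOn ℂ G (Metric.ball 0 1)) {δ : ℝ}
    (hδ : 0 < δ) :
    ∫ s in (0 : ℝ)..1, G (Complex.exp (-2 * Real.pi * Complex.I * (s - δ * Complex.I))) = G 0 := by
  set r : ℝ := Real.exp (-2 * Real.pi * δ) with hr
  have hr0 : 0 < r := Real.exp_pos _
  have hr1 : r < 1 := by
    rw [hr, Real.exp_lt_one_iff]
    have := mul_pos Real.pi_pos hδ
    linarith
  have hsub : Metric.closedBall (0 : ℂ) r ⊆ Metric.ball 0 1 := Metric.closedBall_subset_ball hr1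
  have hmean : Real.circleAverage G 0 r = G 0 := by
    refine DiffContOnCl.circleAverage ?_
    rw [abs_of_pos hr0]
    exact (hG.mono hsub).diffContOnCl_ball subset_rfl
  have hcirc : ∀ s : ℝ, Complex.exp (-2 * Real.pi * Complex.I * (s - δ * Complex.I)) =
      circleMap 0 r (2 * Real.pi * (1 - s)) := by
    intro s
    rw [circleMap, zero_add, hr, Complex.ofReal_exp, ← Complex.exp_add]
    refine Complex.exp_eq_exp_iff_exists_int.2 ⟨-1, ?_⟩
    push_cast
    linear_combination (2 * Real.pi * δ : ℂ) * Complex.I_mul_I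
  rw [← hmean, Real.circleAverage_def]
  simp only [hcirc]
  rw [intervalIntegral.integral_comp_sub_left (fun s => G (circleMap 0 r (2 * Real.pi * s))),
    intervalIntegral.integral_comp_mul_left (fun θ => G (circleMap 0 r θ)) (by positivity)]
  simp

/-- The integrand is a function of `X = e^{-2πi x₁}` that is holomorphic in the unit disc; passing
from `x` to `-x` inverts `X`, so `X / (X - 1)` becomes `1 / (1 - X)`. -/
theorem scalarProduct_psi {k : ℕ} {ξ₁ : ℂ} (hξ : ∀ i < k, ξ₁ - 1 ≠ (i : ℂ)) (c : ℂ) {δ : ℝ}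
    (hδ : 0 < δ) :
    scalarProduct (Irr.form (2 * k)) δ (psi ξ₁ (c • Irr.vec (2 * k) k))
        (psi ξ₁ (c • Irr.vec (2 * k) k)) =
      c ^ 2 * (2 * k)! *
        ((∏ i ∈ Finset.range k, (ξ₁ + 1 + i)) / ∏ i ∈ Finset.range k, (ξ₁ - 1 - i)) := by
  set G : ℂ → ℂ := fun X =>
    c ^ 2 * (2 * k)! * (hypPoly k ξ₁ (X / (X - 1)) * hypPoly k ξ₁ (1 / (1 - X))) with hG
  have hdiff : DifferentiableOn ℂ G (Metric.ball 0 1) := by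
    intro X hX
    have hX1 : X ≠ 1 := by
      rintro rfl
      simp at hX
    have h1 : X - 1 ≠ 0 := sub_ne_zero.2 hX1
    have h2 : 1 - X ≠ 0 := sub_ne_zero.2 hX1.symm
    refine DifferentiableAt.differentiableWithinAt ?_
    simp only [hG, hypPoly]
    fun_prop (disch := assumption)
  have hG0 : G 0 = c ^ 2 * (2 * k)! *
      ((∏ i ∈ Finset.range k, (ξ₁ + 1 + i)) / ∏ i ∈ Finset.range k, (ξ₁ - 1 - i)) := by
    simp only [hG, zero_div, sub_zero, div_one, hypPoly_zero, hypPoly_one hξ, one_mul]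
  rw [← hG0, ← integral_exp_eq G hdiff hδ, scalarProduct]
  refine intervalIntegral.integral_congr fun s _ => ?_
  set x : ℂ := s - δ * Complex.I with hx
  set X : ℂ := Complex.exp (-2 * Real.pi * Complex.I * x) with hX
  have hX0 : X ≠ 0 := Complex.exp_ne_zero _
  have hnorm : ‖X‖ < 1 := by
    rw [hX, Complex.norm_exp, Real.exp_lt_one_iff]
    have := mul_pos Real.pi_pos hδ
    simp [hx]
    linarith
  have hXinv : Complex.exp (-2 * Real.pi * Complex.I * -x) = X⁻¹ := by
    rw [hX, ← Complex.exp_neg]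
    congr 1
    ring
  have hninv : ‖X⁻¹‖ ≠ 1 := by
    rw [norm_inv]
    exact fun h => hnorm.ne (inv_eq_one.1 h)
  have hX1 : X ≠ 1 := by
    intro h
    rw [h, norm_one] at hnorm
    exact lt_irrefl _ hnorm
  have hquot : X⁻¹ / (X⁻¹ - 1) = 1 / (1 - X) := by
    have h2 : 1 - X ≠ 0 := sub_ne_zero.2 hX1.symm
    have h3 : X⁻¹ - 1 ≠ 0 := sub_ne_zero.2 fun h => hX1 (inv_eq_one.1 h)
    rw [div_eq_div_iff h3 h2]
    field_simp
  have hexp : Complex.exp (Real.pi * Complex.I * ξ₁ * x) *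
      Complex.exp (Real.pi * Complex.I * ξ₁ * -x) = 1 := by
    rw [← Complex.exp_add]
    simp
  rw [psi_eq k ξ₁ c x hX.symm hnorm.ne, psi_eq k ξ₁ c (-x) hXinv hninv, hquot]
  simp only [map_smul, LinearMap.smul_apply, smul_eq_mul, form_vec, hG]
  linear_combination (c ^ 2 * (2 * k)! * (hypPoly k ξ₁ (X / (X - 1)) *
    hypPoly k ξ₁ (1 / (1 - X)))) * hexp

end KZB

end

theorem theorem9p2 (k : ℕ) (ξ₁ : ℂ) (t : Fin k → ℂ) (ht : KZB.IsCriticalPoint k ξ₁ t) :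
    (∀ j ∈ Finset.Icc 1 k, ξ₁ ≠ (j : ℂ)) ∧
    KZB.weightFunction t ∈ KZB.zeroWeightAnn (KZB.Irr (2 * k)) (ξ₁ - 1) ∧
    ∀ δ : ℝ, 0 < δ →
      KZB.scalarProduct (KZB.Irr.form (2 * k)) δ
          (KZB.psi ξ₁ (KZB.weightFunction t)) (KZB.psi ξ₁ (KZB.weightFunction t)) =
        ((∏ j ∈ Finset.Icc 1 k, (ξ₁ + j)) ^ 3 * (k.factorial : ℂ)) /
          ((∏ j ∈ Finset.Icc 1 k, (ξ₁ - j)) * ∏ j ∈ Finset.Icc 1 k, ((k : ℂ) + j)) := by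
  have hξ : ∀ i < k, ξ₁ - 1 ≠ (i : ℂ) := fun i hi h =>
    ht.xi_ne i hi (by linear_combination h)
  refine ⟨fun j hj h => ?_, ?_, fun δ hδ => ?_⟩
  · obtain ⟨h1, h2⟩ := Finset.mem_Icc.1 hj
    refine hξ (j - 1) (by omega) ?_
    rw [h, Nat.cast_sub h1, Nat.cast_one]
  · rw [KZB.weightFunction_eq]
    exact Submodule.smul_mem _ _ (KZB.vec_mem_zeroWeightAnn hξ)
  · have hQ := ht.prod_one_sub
    have hc : KZB.weightCoeff t * ∏ i, (1 - t i) = (-1) ^ k := by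
      rw [KZB.weightCoeff_eq t ht.injective ht.ne_one, ← Finset.prod_mul_distrib]
      calc ∏ i, 1 / (t i - 1) * (1 - t i) = ∏ _i : Fin k, (-1 : ℂ) :=
            Finset.prod_congr rfl fun i _ => by
              have := sub_ne_zero.2 (ht.ne_one i)
              field_simp
              ring
        _ = (-1) ^ k := by simp
    rw [KZB.weightFunction_eq, KZB.scalarProduct_psi hξ _ hδ, KZB.prod_Icc_one, KZB.prod_Icc_one,
      KZB.prod_Icc_one]
    have e1 : ∏ i ∈ Finset.range k, (ξ₁ + ((i + 1 : ℕ) : ℂ)) =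
        ∏ i ∈ Finset.range k, (ξ₁ + 1 + i) :=
      Finset.prod_congr rfl fun i _ => by push_cast; ring
    have e2 : ∏ i ∈ Finset.range k, (ξ₁ - ((i + 1 : ℕ) : ℂ)) =
        ∏ i ∈ Finset.range k, (ξ₁ - 1 - i) :=
      Finset.prod_congr rfl fun i _ => by push_cast; ring
    have e3 : (k ! : ℂ) * ∏ i ∈ Finset.range k, ((k : ℂ) + ((i + 1 : ℕ) : ℂ)) =
        ((2 * k)! : ℂ) := by
      rw [← KZB.factorial_mul_prod_range]
      congr 1
      exact Finset.prod_congr rfl fun i _ => by push_cast; ring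
    have hden : ∏ i ∈ Finset.range k, (ξ₁ - 1 - i) ≠ 0 :=
      Finset.prod_ne_zero_iff.2 fun i hi => sub_ne_zero.2 (hξ i (Finset.mem_range.1 hi))
    have hf : (k ! : ℂ) ≠ 0 := Nat.cast_ne_zero.2 k.factorial_ne_zero
    have hf2 : ((2 * k)! : ℂ) ≠ 0 := Nat.cast_ne_zero.2 (2 * k).factorial_ne_zero
    rw [e1, e2]
    have hK : ∏ i ∈ Finset.range k, ((k : ℂ) + ((i + 1 : ℕ) : ℂ)) ≠ 0 :=
      right_ne_zero_of_mul (e3 ▸ hf2)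
    set P := ∏ i ∈ Finset.range k, (ξ₁ + 1 + i)
    set D := ∏ i ∈ Finset.range k, (ξ₁ - 1 - i)
    set K := ∏ i ∈ Finset.range k, ((k : ℂ) + ((i + 1 : ℕ) : ℂ))
    set c := KZB.weightCoeff t
    -- `c (2 k)! = ± k! P`, from the value of `∏ (1 - t_i)`.
    have h1 : c * (2 * k)! = (-1) ^ k * (k ! * P) := by
      rw [← hQ, ← hc]
      ring
    have hs : ((-1 : ℂ) ^ k) ^ 2 = 1 := by rw [← pow_mul, mul_comm, pow_mul]; simp
    have h2 : c ^ 2 * (2 * k)! * K = k ! * P ^ 2 := by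
      refine mul_right_cancel₀ hf ?_
      linear_combination (c * (2 * k)! + (-1) ^ k * (k ! * P)) * h1 + c ^ 2 * (2 * k)! * e3 +
        k ! ^ 2 * P ^ 2 * hs
    field_simp
    linear_combination P * h2
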